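/- Let $P\ge 0$, $P_2\ge 0$. For each $n$ let $S_1^n$ be i.i.d. $N(0,1)$ and $S_2^n$ be i.i.d. $N(0,P_2)$, independent of $S_1^n$. A code of block length $n$ consists of an encoder (helper) $f:\mathbb{R}^n\to\mathbb{R}^n$, $X^n=f(S_2^n)$ (noncausal knowledge of the interference), and a decoder $g:\mathbb{R}^n\to\mathbb{R}^n$, $\hat S_1^n=g(Y^n)$, where $Y^n=X^n+S_1^n+S_2^n$. Its power is $\frac1n E\sum_{i=1}^n X_i^2$ and its distortion is $\frac1n E\sum_{i=1}^n (S_{1i}-\hat S_{1i})^2$. A number $D$ is achievable under the power constraint $P$ if there are $\varepsilon_n\to 0$ and codes of block length $n$ with power at most $P+\varepsilon_n$ for every $n$, such that the limit superior of their distortions as $n\to\infty$ is at most $D$. Let $D(P)_{\min}$ be the infimum of all achievable $D$. **Theorem.** For every $\gamma\ge 1$, $c\in\mathbb{R}$ and $r\ge 0$ such that $P_I:=(1+c)^2P_2+rP$ is nonzero, $$\begin{aligned}(\gamma-1)D(P)_{\min}\ \ge\ &\ln\frac{1+\gamma P_I}{1+P_I}+\frac{1}{1+\gamma P_I}-\frac{1}{1+P_I}-\frac{P_2}{P_I(1+\gamma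 P_I)}+\frac{P_2}{P_I(1+P_I)}-\frac{c^2\gamma}{1+\gamma rP}P_2\\&-\frac{1}{1+\gamma rP}+1+\ln\frac{1}{1+\gamma rP}+a\,x^{*2}-b\,x^*,\end{aligned}$$ where $$a=\frac{1}{P_I(1+P_I)}-\frac{1}{P_I(1+\gamma P_I)}-\frac{\gamma}{1+\gamma rP},\qquad b=\left|2\left(\frac{1}{P_I(1+P_I)}-\frac{1}{P_I(1+\gamma P_I)}+\frac{c\gamma}{1+\gamma rP}\right)\right|\sqrt{P_2},$$ and $x^*=\sqrt P$ if $a\le 0$; $x^*=b/(2a)$ if $a>0$ and $b/(2a)<\sqrt P$; $x^*=\sqrt P$ otherwise. -/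

import Mathlib

open MeasureTheory ProbabilityTheory Filter Topology
open scoped ENNReal NNReal

namespace GaussianHelper

/-- The law of `n` independent copies of an `N(0, v)` random variable. -/
noncomputable def iidGaussian (n : ℕ) (v : ℝ≥0) : Measure (Fin n → ℝ) :=
  Measure.pi fun _ => gaussianReal 0 v

/-- A (deterministic, noncausal) code of block length `n`: the encoder maps the whole interference
sequence `S₂ⁿ` to the channel input `Xⁿ`, the decoder maps the channel output `Yⁿ` to the
reconstruction of `S₁ⁿ`. -/
structure Code (n : ℕ) where
  /-- the encoder -/
  enc : (Fin n → ℝ) → (Fin n → ℝ)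
  /-- the decoder -/
  dec : (Fin n → ℝ) → (Fin n → ℝ)
  measurable_enc : Measurable enc
  measurable_dec : Measurable dec

/-- The expected per-symbol power `E ∑ Xᵢ² / n` of the encoder, where `Xⁿ = enc S₂ⁿ` and `S₂ⁿ` is
i.i.d. `N(0, P₂)`. It takes the value `∞` when the power is not integrable. -/
noncomputable def Code.cost {n : ℕ} (code : Code n) (P₂ : ℝ≥0) : ℝ≥0∞ :=
  ∫⁻ s₂, ENNReal.ofReal ((∑ i, (code.enc s₂ i) ^ 2) / n) ∂(iidGaussian n P₂)

/-- The expected per-symbol distortion `E ∑ (S₁ᵢ - Ŝ₁ᵢ)² / n`, where `S₁ⁿ` is i.i.d. `N(0, 1)`,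
`S₂ⁿ` is i.i.d. `N(0, P₂)` and independent of `S₁ⁿ`, `Yⁿ = Xⁿ + S₁ⁿ + S₂ⁿ`, and `Ŝ₁ⁿ = dec Yⁿ`. It
takes the value `∞` when the squared error is not integrable. -/
noncomputable def Code.distortion {n : ℕ} (code : Code n) (P₂ : ℝ≥0) : ℝ≥0∞ :=
  ∫⁻ s : (Fin n → ℝ) × (Fin n → ℝ),
    ENNReal.ofReal ((∑ i, (s.1 i - code.dec (code.enc s.2 + s.1 + s.2) i) ^ 2) / n)
    ∂((iidGaussian n 1).prod (iidGaussian n P₂))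

/-- The distortion `D` is achievable under the power constraint `P`: there are codes of every block
length `n`, of power at most `P + εₙ` with `εₙ → 0`, whose distortions have limit superior at most
`D`. (Slacks `εₙ` of either sign may be replaced by `|εₙ|`, so they are taken nonnegative.) -/
def Achievable (P₂ P D : ℝ≥0) : Prop :=
  ∃ (ε : ℕ → ℝ≥0) (code : (n : ℕ) → Code n),
    Tendsto ε atTop (𝓝 0) ∧
    (∀ n, (code n).cost P₂ ≤ ((P + ε n : ℝ≥0) : ℝ≥0∞)) ∧
    limsup (fun n => (code n).distortion P₂) atTop ≤ (D : ℝ≥0∞)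

/-- The minimum achievable distortion `D(P)_min`: the infimum of the achievable distortions. -/
noncomputable def minDistortion (P₂ P : ℝ≥0) : ℝ≥0 :=
  sInf {D : ℝ≥0 | Achievable P₂ P D}

/-- Distortion `1` is always achievable (send nothing and reconstruct by zero), so the infimum
defining `minDistortion` is over a nonempty set. -/
theorem achievable_one (P₂ P : ℝ≥0) : Achievable P₂ P 1 := by
  refine ⟨fun _ => 0, fun n => ⟨fun _ => 0, fun _ => 0, measurable_const, measurable_const⟩,
    tendsto_const_nhds, fun n => ?_, ?_⟩
  · simp [Code.cost]
  · refine limsup_le_of_le (by isBoundedDefault) (Eventually.of_forall fun n => ?_)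
    rcases Nat.eq_zero_or_pos n with rfl | hn
    · simp [Code.distortion]
    have : IsProbabilityMeasure (iidGaussian n 1) := by unfold iidGaussian; infer_instance
    have : IsProbabilityMeasure (iidGaussian n P₂) := by unfold iidGaussian; infer_instance
    have hI : ∫⁻ x, ENNReal.ofReal (x ^ 2) ∂(gaussianReal 0 1) = 1 := by
      have hint : Integrable (fun x : ℝ => x ^ 2) (gaussianReal 0 1) :=
        (memLp_id_gaussianReal (μ := 0) (v := 1) 2).integrable_sq
      rw [← ofReal_integral_eq_lintegral_ofReal hint (Eventually.of_forall fun x => sq_nonneg x)]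
      have h := variance_of_integral_eq_zero (μ := gaussianReal 0 1) (X := id)
        measurable_id.aemeasurable (by simp)
      simp only [variance_id_gaussianReal, id] at h
      rw [← h]; simp
    have hn' : (0 : ℝ) < n := by exact_mod_cast hn
    have hE : ∀ i : Fin n, ∫⁻ s : (Fin n → ℝ) × (Fin n → ℝ), ENNReal.ofReal (s.1 i ^ 2)
        ∂((iidGaussian n 1).prod (iidGaussian n P₂)) = 1 := by
      intro i
      have h1 : MeasurePreserving (fun s : (Fin n → ℝ) × (Fin n → ℝ) => s.1 i)
          ((iidGaussian n 1).prod (iidGaussian n P₂)) (gaussianReal 0 1) :=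
        (measurePreserving_eval (fun _ : Fin n => gaussianReal 0 1) i).comp
          (measurePreserving_fst (μ := iidGaussian n 1) (ν := iidGaussian n P₂))
      rw [← hI, ← h1.lintegral_comp (by fun_prop)]
    simp only [Code.distortion, Pi.zero_apply, sub_zero]
    have hp : ∀ s : (Fin n → ℝ) × (Fin n → ℝ), ENNReal.ofReal ((∑ i, s.1 i ^ 2) / n)
        = (∑ i, ENNReal.ofReal (s.1 i ^ 2)) * (n : ℝ≥0∞)⁻¹ := by
      intro s
      rw [ENNReal.ofReal_div_of_pos hn', ENNReal.ofReal_sum_of_nonneg fun _ _ => sq_nonneg _,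
        ENNReal.ofReal_natCast, ENNReal.div_eq_inv_mul, mul_comm]
    simp only [hp]
    rw [lintegral_mul_const _ (by fun_prop), lintegral_finsetSum _ (by fun_prop)]
    simp only [hE]
    simp [ENNReal.mul_inv_cancel, hn.ne']

end GaussianHelper

namespace GaussianHelper

/-! The bound is nonnegativity of a relative entropy, with a well-chosen comparison law. Adjoin a
fictitious side observation `Y' = d (X + S₂) + B`, with `d² = γ - 1` and fresh standard noise `B`.
Then `U = Y + d Y' = γ (X + S₂) + S₁ + d B` carries noise of variance `γ`.

Under the comparison law, `Y` is i.i.d. `N(0, α)`. Given `Y`, the side observation is `N(d (Y -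
g(Y)), 1)`, as if `g` guessed the noise exactly. Given both, `S₂` has the posterior it would have if
`U` were `γ (1 + c) S₂` plus noise of variance `γ κ`. The density with respect to the true law has
total mass one (`Code.lintegral_exp_blockLogRatio`), so its expected logarithm is at most zero.

That expectation involves only second moments. The residual of `Y'` is `B - d E`, with `E` the
estimation error, so the distortion enters as `(γ - 1) e`. The rest is affine in the power `x` and
the correlation `w` of input and interference. The choices `α = 1 + P_I`, `κ = 1 + γ r P`, `β = 1 +
γ P_I` make the coefficient of `x` equal to `a` and that of `w` equal to `± b / √P₂` when `P₂ ≠ 0`.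
Cauchy-Schwarz then leaves `a z² - b z` at `z = √x`, which `x*` minimizes over `[0, √P]`. The excess
power costs a vanishing slack. -/

/-! ### Gaussian product measures and their densities. -/

instance isProbabilityMeasure_iidGaussian (n : ℕ) (v : ℝ≥0) :
    IsProbabilityMeasure (iidGaussian n v) := by
  unfold iidGaussian; infer_instance

/-- Tonelli for a product of integrable nonnegative functions of the single coordinates. -/
theorem lintegral_pi_prod_ofReal {ι : Type*} [Fintype ι] {α : ι → Type*}
    [∀ i, MeasurableSpace (α i)] (μ : ∀ i, Measure (α i)) [∀ i, SigmaFinite (μ i)]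
    (f : ∀ i, α i → ℝ) (hf : ∀ i, Integrable (f i) (μ i)) (h0 : ∀ i x, 0 ≤ f i x) :
    ∫⁻ x, ∏ i, ENNReal.ofReal (f i (x i)) ∂(Measure.pi μ) =
      ∏ i, ∫⁻ x, ENNReal.ofReal (f i x) ∂(μ i) := by
  have h1 : ∀ x : ∀ i, α i, ∏ i, ENNReal.ofReal (f i (x i)) = ENNReal.ofReal (∏ i, f i (x i)) :=
    fun x => (ENNReal.ofReal_prod_of_nonneg fun i _ => h0 i (x i)).symm
  simp_rw [h1]
  rw [← ofReal_integral_eq_lintegral_ofReal (Integrable.fintype_prod_dep hf)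
    (Eventually.of_forall fun x => Finset.prod_nonneg fun i _ => h0 i (x i)),
    integral_fintype_prod_eq_prod,
    ENNReal.ofReal_prod_of_nonneg fun i _ => integral_nonneg (h0 i)]
  exact Finset.prod_congr rfl fun i _ =>
    ofReal_integral_eq_lintegral_ofReal (hf i) (Eventually.of_forall (h0 i))

/-- Tonelli for a product of functions of the single coordinates. -/
theorem lintegral_pi_prod {ι : Type*} [Fintype ι] {α : ι → Type*} [∀ i, MeasurableSpace (α i)]
    (μ : ∀ i, Measure (α i)) [∀ i, IsProbabilityMeasure (μ i)] (f : ∀ i, α i → ℝ≥0∞)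
    (hf : ∀ i, Measurable (f i)) :
    ∫⁻ x, ∏ i, f i (x i) ∂(Measure.pi μ) = ∏ i, ∫⁻ x, f i x ∂(μ i) := by
  have h : iIndepFun (fun i (x : ∀ j, α j) => f i (x i)) (Measure.pi μ) :=
    iIndepFun_pi fun i => (hf i).aemeasurable
  rw [lintegral_prod_eq_prod_lintegral_of_indepFun Finset.univ _ h
    (fun i => (hf i).comp (measurable_pi_apply i))]
  refine Finset.prod_congr rfl fun i _ => ?_
  exact (measurePreserving_eval μ i).lintegral_comp (hf i)

theorem iidGaussian_eq_withDensity (n : ℕ) {v : ℝ≥0} (hv : v ≠ 0) :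
    iidGaussian n v =
      (volume : Measure (Fin n → ℝ)).withDensity fun x => ∏ i, gaussianPDF 0 v (x i) := by
  unfold iidGaussian
  refine Measure.pi_eq (μ := fun _ : Fin n => gaussianReal 0 v) fun s hs => ?_
  rw [withDensity_apply _ (MeasurableSet.univ_pi hs), volume_pi,
    Measure.restrict_pi_pi (fun _ : Fin n => (volume : Measure ℝ)) s]
  simp only [gaussianPDF]
  rw [lintegral_pi_prod_ofReal _ (fun _ => gaussianPDFReal 0 v)
    (fun i => (integrable_gaussianPDFReal 0 v).restrict)
    (fun _ => gaussianPDFReal_nonneg 0 v)]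
  exact Finset.prod_congr rfl fun i _ => (gaussianReal_apply 0 hv (s i)).symm

theorem lintegral_iidGaussian_eq_shift (n : ℕ) {v : ℝ≥0} (hv : v ≠ 0) (a : Fin n → ℝ)
    {f : (Fin n → ℝ) → ℝ≥0∞} (hf : Measurable f) :
    ∫⁻ x, f x ∂(iidGaussian n v) =
      ∫⁻ y, (∏ i, gaussianPDF 0 v (y i - a i)) * f (y - a) := by
  have hm : Measurable fun x : Fin n → ℝ => ∏ i, gaussianPDF 0 v (x i) :=
    Finset.measurable_prod _ fun i _ => (measurable_gaussianPDF 0 v).comp (measurable_pi_apply i)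
  rw [iidGaussian_eq_withDensity n hv, lintegral_withDensity_eq_lintegral_mul _ hm hf,
    ← lintegral_sub_right_eq_self _ a]
  rfl

theorem lintegral_prod_gaussianPDF (n : ℕ) {v : ℝ≥0} (hv : v ≠ 0) (a : Fin n → ℝ) :
    ∫⁻ y : Fin n → ℝ, ∏ i, gaussianPDF 0 v (y i - a i) = 1 := by
  have h := lintegral_iidGaussian_eq_shift n hv a (f := fun _ => 1) measurable_const
  simpa using h.symm

theorem gaussianPDF_toNNReal_eq_exp (m x : ℝ) {v : ℝ} (hv : 0 < v) :
    gaussianPDF m v.toNNReal x = ENNReal.ofReal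
      (Real.exp (-(Real.log (2 * Real.pi) + Real.log v) / 2 - (x - m) ^ 2 / (2 * v))) := by
  have hp : 0 < 2 * Real.pi := by positivity
  rw [gaussianPDF, gaussianPDFReal, Real.coe_toNNReal _ hv.le,
    sub_eq_add_neg (-(Real.log _ + _) / 2), Real.exp_add]
  congr 2
  · rw [← Real.log_mul hp.ne' hv.ne', neg_div, Real.exp_neg, Real.exp_half,
      Real.exp_log (by positivity)]
  · rw [neg_div]

/-! ### The comparison law and its total mass. -/

/-- The logarithm of the ratio of the Gaussian densities `N(γ(1+c)s, γκ)` and `N(0, γβ)` at `t`. -/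
noncomputable def channelLogRatio (γ c β κ t s : ℝ) : ℝ :=
  (Real.log β - Real.log κ) / 2 + t ^ 2 / (2 * (γ * β))
    - (t - γ * (1 + c) * s) ^ 2 / (2 * (γ * κ))

/-- By Bayes' rule: `N(0, γβ)` is the marginal of `γ (1 + c) S` plus noise of variance `γκ`, so
prior times likelihood over marginal is a posterior density in `s`. -/
theorem lintegral_exp_channelLogRatio (p : ℝ≥0) {γ c β κ : ℝ} (hγ : 0 < γ) (hκ : 0 < κ)
    (hβ : β = κ + γ * (1 + c) ^ 2 * p) (t : ℝ) :
    ∫⁻ s, ENNReal.ofReal (Real.exp (channelLogRatio γ c β κ t s)) ∂(gaussianReal 0 p) = 1 := by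
  have hm : Measurable fun s => ENNReal.ofReal (Real.exp (channelLogRatio γ c β κ t s)) := by
    unfold channelLogRatio; fun_prop
  by_cases hp : p = 0
  · subst hp
    have : β = κ := by simp [hβ]
    rw [gaussianReal_zero_var, lintegral_dirac' _ hm]
    simp [channelLogRatio, this]
  · have hp0 : (0 : ℝ) < p := by positivity
    have hβ0 : 0 < β := by rw [hβ]; positivity
    have hv : 0 < p * κ / β := by positivity
    rw [gaussianReal_of_var_ne_zero 0 hp,
      lintegral_withDensity_eq_lintegral_mul _ (measurable_gaussianPDF 0 p) hm,
      -- Posterior mean and variance of `S` given `t`, found by completing the square in `s`.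
      ← lintegral_gaussianPDF_eq_one ((1 + c) * p * t / β)
        (v := (p * κ / β).toNNReal) (by simpa using hv)]
    refine lintegral_congr fun s => ?_
    have h1 := gaussianPDF_toNNReal_eq_exp 0 s hp0
    rw [Real.toNNReal_coe] at h1
    rw [Pi.mul_apply, h1, gaussianPDF_toNNReal_eq_exp _ _ hv,
      ← ENNReal.ofReal_mul (Real.exp_nonneg _), ← Real.exp_add]
    congr 2
    rw [channelLogRatio, Real.log_div (by positivity) hβ0.ne', Real.log_mul hp0.ne' hκ.ne']
    have key : -((s - 0) ^ 2 / (2 * p)) + t ^ 2 / (2 * (γ * β))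
        - (t - γ * (1 + c) * s) ^ 2 / (2 * (γ * κ))
        = -((s - (1 + c) * p * t / β) ^ 2 / (2 * (p * κ / β))) := by
      field_simp
      rw [hβ]
      ring
    linear_combination key

/-- The logarithm of the likelihood ratio between the comparison law and the true law of one
coordinate of (interference, output, side observation), as a function of the noise `A`, the noise
`B` of the side observation, the interference `S`, the channel input `X` and the error `E`. -/
noncomputable def logLikelihoodRatio (γ c d α β κ A B S X E : ℝ) : ℝ :=
  A ^ 2 / 2 + B ^ 2 / 2 - Real.log α / 2 - (X + S + A) ^ 2 / (2 * α) - (B - d * E) ^ 2 / 2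
    + channelLogRatio γ c β κ (γ * (X + S) + A + d * B) S

/-- In the output coordinates `y`, `y'`, the true density times the likelihood ratio factors as the
comparison law: `y`, then `y'` given `y`, then the posterior factor. The input drops out because `1
+ d² = γ`. -/
theorem gaussianPDF_mul_exp_logLikelihoodRatio {γ d α : ℝ} (c β κ : ℝ) (hα : 0 < α)
    (hd : d ^ 2 = γ - 1) (y y' S X g : ℝ) :
    gaussianPDF 0 1 (y - (X + S)) * (gaussianPDF 0 1 (y' - d * (X + S)) *
      ENNReal.ofReal (Real.exp (logLikelihoodRatio γ c d α β κ (y - (X + S))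
        (y' - d * (X + S)) S X (y - (X + S) - g)))) =
    gaussianPDF 0 α.toNNReal (y - 0) * (gaussianPDF 0 1 (y' - d * (y - g)) *
      ENNReal.ofReal (Real.exp (channelLogRatio γ c β κ (y + d * y') S))) := by
  have h1 (x : ℝ) := gaussianPDF_toNNReal_eq_exp 0 x one_pos
  simp only [Real.toNNReal_one] at h1
  rw [h1, h1, h1, gaussianPDF_toNNReal_eq_exp _ _ hα]
  simp only [← ENNReal.ofReal_mul (Real.exp_nonneg _), ← Real.exp_add]
  congr 2
  have hu : γ * (X + S) + (y - (X + S)) + d * (y' - d * (X + S)) = y + d * y' := by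
    linear_combination -(X + S) * hd
  rw [logLikelihoodRatio, hu]
  have : X + S + (y - (X + S)) = y := by ring
  rw [this]
  simp only [Real.log_one]
  ring

variable {n : ℕ}

/-- The log-likelihood ratio of a whole block. -/
noncomputable def Code.blockLogRatio (code : Code n) (γ c d α β κ : ℝ)
    (ω : ((Fin n → ℝ) × (Fin n → ℝ)) × (Fin n → ℝ)) : ℝ :=
  ∑ i, logLikelihoodRatio γ c d α β κ (ω.1.1 i) (ω.2 i) (ω.1.2 i) (code.enc ω.1.2 i)
    (ω.1.1 i - code.dec (code.enc ω.1.2 + ω.1.1 + ω.1.2) i)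

theorem Code.measurable_blockLogRatio (code : Code n) (γ c d α β κ : ℝ) :
    Measurable (code.blockLogRatio γ c d α β κ) := by
  have := code.measurable_enc
  have := code.measurable_dec
  unfold Code.blockLogRatio logLikelihoodRatio channelLogRatio
  fun_prop

/-- For fixed `s` the input is constant, so translations replace the noises by the outputs `y`,
`y'`. The integrand then factors, and integrating out `s`, `y'`, `y` in that order gives `1` each
time. -/
theorem Code.lintegral_exp_blockLogRatio (code : Code n) (p : ℝ≥0) {γ c d α β κ : ℝ}
    (hγ : 0 < γ) (hα : 0 < α) (hκ : 0 < κ) (hβ : β = κ + γ * (1 + c) ^ 2 * p)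
    (hd : d ^ 2 = γ - 1) :
    ∫⁻ ω, ENNReal.ofReal (Real.exp (code.blockLogRatio γ c d α β κ ω))
      ∂(((iidGaussian n 1).prod (iidGaussian n p)).prod (iidGaussian n 1)) = 1 := by
  have hL := code.measurable_blockLogRatio γ c d α β κ
  have henc := code.measurable_enc
  have hdec := code.measurable_dec
  have hα' : α.toNNReal ≠ 0 := by simpa using hα
  have hpdf : ∀ v : ℝ≥0, Measurable (gaussianPDF 0 v) := measurable_gaussianPDF 0
  have hexp : Measurable fun ω => ENNReal.ofReal (Real.exp (code.blockLogRatio γ c d α β κ ω)) := by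
    fun_prop
  have hF : Measurable fun q : (Fin n → ℝ) × (Fin n → ℝ) =>
      ∫⁻ b, ENNReal.ofReal (Real.exp (code.blockLogRatio γ c d α β κ (q, b)))
        ∂(iidGaussian n 1) := hexp.lintegral_prod_right'
  rw [lintegral_prod _ hexp.aemeasurable, lintegral_prod_symm _ hF.aemeasurable]
  have hpt : ∀ s y y' : Fin n → ℝ,
      (∏ i, gaussianPDF 0 1 (y i - (code.enc s + s) i)) *
        ((∏ i, gaussianPDF 0 1 (y' i - (d • (code.enc s + s)) i)) *
          ENNReal.ofReal (Real.exp (code.blockLogRatio γ c d α β κ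
            ((y - (code.enc s + s), s), y' - d • (code.enc s + s))))) =
      (∏ i, gaussianPDF 0 α.toNNReal (y i - 0)) *
        ((∏ i, gaussianPDF 0 1 (y' i - d * (y i - code.dec y i))) *
          ∏ i, ENNReal.ofReal (Real.exp (channelLogRatio γ c β κ (y i + d * y' i) (s i)))) := by
    intro s y y'
    rw [Code.blockLogRatio, Real.exp_sum,
      ENNReal.ofReal_prod_of_nonneg fun i _ => Real.exp_nonneg _]
    simp only [← Finset.prod_mul_distrib]
    refine Finset.prod_congr rfl fun i _ => ?_
    have hy : code.enc s + (y - (code.enc s + s)) + s = y := by abel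
    simp only [hy]
    exact gaussianPDF_mul_exp_logLikelihoodRatio c β κ hα hd _ _ _ _ _
  have hinner : ∀ s : Fin n → ℝ,
      ∫⁻ a, ∫⁻ b, ENNReal.ofReal (Real.exp (code.blockLogRatio γ c d α β κ ((a, s), b)))
        ∂(iidGaussian n 1) ∂(iidGaussian n 1) =
      ∫⁻ y : Fin n → ℝ, ∫⁻ y' : Fin n → ℝ, (∏ i, gaussianPDF 0 α.toNNReal (y i - 0)) *
        ((∏ i, gaussianPDF 0 1 (y' i - d * (y i - code.dec y i))) *
          ∏ i, ENNReal.ofReal (Real.exp (channelLogRatio γ c β κ (y i + d * y' i) (s i)))) := by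
    intro s
    refine (lintegral_iidGaussian_eq_shift n one_ne_zero (code.enc s + s)
      (hF.comp (measurable_id.prodMk (measurable_const (a := s))))).trans ?_
    refine lintegral_congr fun y => ?_
    have hsec : Measurable fun b : Fin n → ℝ => ENNReal.ofReal (Real.exp
        (code.blockLogRatio γ c d α β κ ((y - (code.enc s + s), s), b))) := by fun_prop
    simp only [Function.comp_apply, id]
    rw [lintegral_iidGaussian_eq_shift n one_ne_zero (d • (code.enc s + s)) hsec,
      ← lintegral_const_mul _ (by fun_prop)]
    exact lintegral_congr fun y' => hpt s y y'
  simp_rw [hinner]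
  have hK : Measurable fun q : ((Fin n → ℝ) × (Fin n → ℝ)) × (Fin n → ℝ) =>
      (∏ i, gaussianPDF 0 α.toNNReal (q.1.2 i - 0)) *
        ((∏ i, gaussianPDF 0 1 (q.2 i - d * (q.1.2 i - code.dec q.1.2 i))) *
          ∏ i, ENNReal.ofReal
            (Real.exp (channelLogRatio γ c β κ (q.1.2 i + d * q.2 i) (q.1.1 i)))) := by
    unfold channelLogRatio; fun_prop
  -- The decoder sees only `y`, so `y` must be integrated last.
  rw [lintegral_lintegral_swap hK.lintegral_prod_right'.aemeasurable]
  rw [← lintegral_prod_gaussianPDF n hα' 0]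
  refine lintegral_congr fun y => ?_
  have hKy := hK.comp
    ((measurable_fst.prodMk (measurable_const (a := y))).prodMk measurable_snd)
  rw [lintegral_lintegral_swap (f := fun s y' : Fin n → ℝ =>
    (∏ i, gaussianPDF 0 α.toNNReal (y i - 0)) *
      ((∏ i, gaussianPDF 0 1 (y' i - d * (y i - code.dec y i))) *
        ∏ i, ENNReal.ofReal (Real.exp (channelLogRatio γ c β κ (y i + d * y' i) (s i)))))
    hKy.aemeasurable]
  have hs : ∀ y' : Fin n → ℝ, ∫⁻ s : Fin n → ℝ,
      ∏ i, ENNReal.ofReal (Real.exp (channelLogRatio γ c β κ (y i + d * y' i) (s i)))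
        ∂(iidGaussian n p) = 1 := by
    intro y'
    rw [iidGaussian, lintegral_pi_prod _ (fun i s => ENNReal.ofReal
      (Real.exp (channelLogRatio γ c β κ (y i + d * y' i) s)))
      (fun i => by unfold channelLogRatio; fun_prop)]
    exact Finset.prod_eq_one fun i _ => lintegral_exp_channelLogRatio p hγ hκ hβ _
  have hms : ∀ y' : Fin n → ℝ, Measurable fun s : Fin n → ℝ =>
      ∏ i, ENNReal.ofReal (Real.exp (channelLogRatio γ c β κ (y i + d * y' i) (s i))) := by
    intro y'; unfold channelLogRatio; fun_prop
  have hy' : ∀ y' : Fin n → ℝ, ∫⁻ s : Fin n → ℝ, (∏ i, gaussianPDF 0 α.toNNReal (y i - 0)) *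
        ((∏ i, gaussianPDF 0 1 (y' i - d * (y i - code.dec y i))) *
          ∏ i, ENNReal.ofReal (Real.exp (channelLogRatio γ c β κ (y i + d * y' i) (s i))))
        ∂(iidGaussian n p) = (∏ i, gaussianPDF 0 α.toNNReal (y i - 0)) *
          ∏ i, gaussianPDF 0 1 (y' i - d * (y i - code.dec y i)) := by
    intro y'
    rw [lintegral_const_mul _ ((hms y').const_mul _), lintegral_const_mul _ (hms y'), hs, mul_one]
  simp_rw [hy']
  rw [lintegral_const_mul _ (by fun_prop),
    lintegral_prod_gaussianPDF n one_ne_zero fun i => d * (y i - code.dec y i), mul_one]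
  rfl

/-! ### Expected log-likelihood ratio from second moments. -/

section Moments

variable {Ω : Type*} [MeasurableSpace Ω]

/-- `f` is integrable with integral `r`. -/
def HasExpectation (μ : Measure Ω) (f : Ω → ℝ) (r : ℝ) : Prop :=
  Integrable f μ ∧ ∫ ω, f ω ∂μ = r

theorem HasExpectation.add {μ : Measure Ω} {f g : Ω → ℝ} {r s : ℝ} (hf : HasExpectation μ f r)
    (hg : HasExpectation μ g s) : HasExpectation μ (fun ω => f ω + g ω) (r + s) :=
  ⟨hf.1.add hg.1, by rw [integral_add hf.1 hg.1, hf.2, hg.2]⟩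

theorem HasExpectation.const_mul {μ : Measure Ω} {f : Ω → ℝ} {r : ℝ} (hf : HasExpectation μ f r)
    (k : ℝ) : HasExpectation μ (fun ω => k * f ω) (k * r) :=
  ⟨hf.1.const_mul k, by rw [integral_const_mul, hf.2]⟩

theorem hasExpectation_const (μ : Measure Ω) [IsProbabilityMeasure μ] (k : ℝ) :
    HasExpectation μ (fun _ => k) k :=
  ⟨integrable_const k, by simp⟩

theorem HasExpectation.congr {μ : Measure Ω} {f g : Ω → ℝ} {r s : ℝ} (hf : HasExpectation μ f r)
    (hfg : ∀ ω, f ω = g ω) (hrs : r = s) : HasExpectation μ g s := by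
  rwa [← hrs, ← funext hfg]

/-- The second moments of the random variables of one coordinate: noise `A`, noise `B` of the side
observation, interference `S`, channel input `X`, error `E`. -/
structure CoordinateMoments (μ : Measure Ω) (A B S X E : Ω → ℝ) (p x w e : ℝ) : Prop where
  noise_sq : HasExpectation μ (fun ω => A ω * A ω) 1
  side_sq : HasExpectation μ (fun ω => B ω * B ω) 1
  interference_sq : HasExpectation μ (fun ω => S ω * S ω) p
  input_sq : HasExpectation μ (fun ω => X ω * X ω) x
  error_sq : HasExpectation μ (fun ω => E ω * E ω) e
  input_interference : HasExpectation μ (fun ω => X ω * S ω) w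
  noise_interference : HasExpectation μ (fun ω => A ω * S ω) 0
  noise_input : HasExpectation μ (fun ω => A ω * X ω) 0
  noise_side : HasExpectation μ (fun ω => A ω * B ω) 0
  interference_side : HasExpectation μ (fun ω => S ω * B ω) 0
  input_side : HasExpectation μ (fun ω => X ω * B ω) 0
  error_side : HasExpectation μ (fun ω => E ω * B ω) 0

variable {μ : Measure Ω} {A B S X E : Ω → ℝ} {p x w e : ℝ}

theorem CoordinateMoments.linear_sq (h : CoordinateMoments μ A B S X E p x w e)
    (k l a b : ℝ) :
    HasExpectation μ (fun ω => (k * X ω + l * S ω + a * A ω + b * B ω) ^ 2)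
      (k ^ 2 * x + 2 * k * l * w + l ^ 2 * p + a ^ 2 + b ^ 2) := by
  refine ((((((((((h.input_sq.const_mul (k ^ 2)).add
    (h.input_interference.const_mul (2 * k * l))).add
    (h.interference_sq.const_mul (l ^ 2))).add (h.noise_sq.const_mul (a ^ 2))).add
    (h.side_sq.const_mul (b ^ 2))).add (h.noise_interference.const_mul (2 * a * l))).add
    (h.noise_input.const_mul (2 * a * k))).add (h.noise_side.const_mul (2 * a * b))).add
    (h.interference_side.const_mul (2 * l * b))).add
    (h.input_side.const_mul (2 * k * b))).congr (fun ω => ?_) ?_ <;> ring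

theorem CoordinateMoments.logLikelihoodRatio [IsProbabilityMeasure μ]
    (h : CoordinateMoments μ A B S X E p x w e) {γ c d α β κ : ℝ} (hγ : 0 < γ)
    (hd : d ^ 2 = γ - 1) :
    HasExpectation μ
      (fun ω => logLikelihoodRatio γ c d α β κ (A ω) (B ω) (S ω) (X ω) (E ω))
      ((Real.log β - Real.log κ - Real.log α) / 2 + 1 / 2 - (x + 2 * w + p + 1) / (2 * α)
        - (γ - 1) * e / 2 + (γ * (x + 2 * w + p) + 1) / (2 * β)
        - (γ * (x - 2 * c * w + c ^ 2 * p) + 1) / (2 * κ)) := by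
  have hE : HasExpectation μ (fun ω => (B ω - d * E ω) ^ 2) (1 + (γ - 1) * e) := by
    refine ((h.side_sq.add (h.error_side.const_mul (-2 * d))).add
      (h.error_sq.const_mul (d ^ 2))).congr (fun ω => ?_) ?_
    · ring
    · rw [hd]; ring
  refine ((((((((hasExpectation_const μ ((Real.log β - Real.log κ - Real.log α) / 2)).add
    (h.noise_sq.const_mul (1 / 2))).add (h.side_sq.const_mul (1 / 2))).add
    ((h.linear_sq 1 1 1 0).const_mul (-1 / (2 * α)))).add (hE.const_mul (-1 / 2))).add
    ((h.linear_sq γ γ 1 d).const_mul (1 / (2 * (γ * β))))).add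
    ((h.linear_sq γ (-(γ * c)) 1 d).const_mul (-1 / (2 * (γ * κ)))))).congr (fun ω => ?_) ?_
  · rw [GaussianHelper.logLikelihoodRatio, channelLogRatio]
    ring
  -- Both second moments involving `U` contain a factor `γ`, since its noise has variance `1 + d² =
  -- γ`.
  · have h1 : ∀ z t : ℝ, (γ * z) / (2 * (γ * t)) = z / (2 * t) := fun z t => by
      rw [mul_left_comm 2 γ t, mul_div_mul_left _ _ hγ.ne']
    rw [← h1 (γ * (x + 2 * w + p) + 1), ← h1 (γ * (x - 2 * c * w + c ^ 2 * p) + 1), hd]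
    ring

end Moments

/-! ### Expectations under products, and the entropy inequality. -/

section Transport

variable {Ω Ω' : Type*} [MeasurableSpace Ω] [MeasurableSpace Ω'] {μ : Measure Ω} {ν : Measure Ω'}

theorem HasExpectation.comp {f : Ω' → ℝ} {r : ℝ} (hf : HasExpectation ν f r) {T : Ω → Ω'}
    (hT : MeasurePreserving T μ ν) : HasExpectation μ (fun ω => f (T ω)) r := by
  refine ⟨hT.integrable_comp_of_integrable hf.1, ?_⟩
  rw [← integral_map hT.aemeasurable (by rw [hT.map_eq]; exact hf.1.aestronglyMeasurable),
    hT.map_eq, hf.2]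

theorem HasExpectation.prod_mul [SFinite μ] [SFinite ν] {f : Ω → ℝ} {g : Ω' → ℝ} {r s : ℝ}
    (hf : HasExpectation μ f r) (hg : HasExpectation ν g s) :
    HasExpectation (μ.prod ν) (fun q => f q.1 * g q.2) (r * s) :=
  ⟨hf.1.mul_prod hg.1, by rw [integral_prod_mul, hf.2, hg.2]⟩

theorem HasExpectation.sum {ι : Type*} {s : Finset ι} {f : ι → Ω → ℝ} {r : ι → ℝ}
    (hf : ∀ i, HasExpectation μ (f i) (r i)) :
    HasExpectation μ (fun ω => ∑ i ∈ s, f i ω) (∑ i ∈ s, r i) :=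
  ⟨integrable_finsetSum _ fun i _ => (hf i).1, by
    rw [integral_finsetSum _ fun i _ => (hf i).1]
    exact Finset.sum_congr rfl fun i _ => (hf i).2⟩

/-- If the mean of the squares of finitely many functions has finite integral, then every function
is square integrable and the integral is the mean of their second moments. -/
theorem memLp_two_of_lintegral_mean_sq {n : ℕ} (hn : 0 < n) {f : Fin n → Ω → ℝ}
    (hf : ∀ i, Measurable (f i))
    (h : ∫⁻ ω, ENNReal.ofReal ((∑ i, f i ω ^ 2) / n) ∂μ ≠ ∞) :
    (∀ i, MemLp (f i) 2 μ) ∧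
      ∫⁻ ω, ENNReal.ofReal ((∑ i, f i ω ^ 2) / n) ∂μ =
        ENNReal.ofReal ((∑ i, ∫ ω, f i ω * f i ω ∂μ) / n) := by
  have hn0 : (0 : ℝ) < n := by exact_mod_cast hn
  have h0 : ∀ ω, 0 ≤ (∑ i, f i ω ^ 2) / n := fun ω => by positivity
  have hint : Integrable (fun ω => (∑ i, f i ω ^ 2) / n) μ :=
    (lintegral_ofReal_ne_top_iff_integrable (by fun_prop) (Eventually.of_forall h0)).1 h
  have hsq : ∀ i, Integrable (fun ω => f i ω ^ 2) μ := fun i => by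
    refine (hint.const_mul n).mono' (by fun_prop) (Eventually.of_forall fun ω => ?_)
    rw [Real.norm_of_nonneg (sq_nonneg _), mul_div_cancel₀ _ hn0.ne']
    exact Finset.single_le_sum (f := fun j => f j ω ^ 2) (fun j _ => sq_nonneg _)
      (Finset.mem_univ i)
  refine ⟨fun i => (memLp_two_iff_integrable_sq (hf i).aestronglyMeasurable).2 (hsq i), ?_⟩
  rw [← ofReal_integral_eq_lintegral_ofReal hint (Eventually.of_forall h0), integral_div,
    integral_finsetSum _ fun i _ => hsq i]
  simp only [sq]

theorem MemLp.hasExpectation_mul {f g : Ω → ℝ} (hf : MemLp f 2 μ) (hg : MemLp g 2 μ) :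
    HasExpectation μ (fun ω => f ω * g ω) (∫ ω, f ω * g ω ∂μ) :=
  ⟨hf.integrable_mul hg, rfl⟩

theorem MemLp.hasExpectation [IsFiniteMeasure μ] {f : Ω → ℝ} (hf : MemLp f 2 μ) :
    HasExpectation μ f (∫ ω, f ω ∂μ) :=
  ⟨hf.integrable one_le_two, rfl⟩

/-- Nonnegativity of relative entropy, by integrating `1 + f ≤ exp f`. -/
theorem HasExpectation.nonpos_of_lintegral_exp [IsProbabilityMeasure μ] {f : Ω → ℝ} {r : ℝ}
    (hf : HasExpectation μ f r)
    (h : ∫⁻ ω, ENNReal.ofReal (Real.exp (f ω)) ∂μ = 1) : r ≤ 0 := by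
  have hexp : Integrable (fun ω => Real.exp (f ω)) μ :=
    (lintegral_ofReal_ne_top_iff_integrable
      (Real.continuous_exp.comp_aestronglyMeasurable hf.1.aestronglyMeasurable)
      (Eventually.of_forall fun ω => (Real.exp_pos _).le)).1 (by simp [h])
  have h1 : ∫ ω, Real.exp (f ω) ∂μ = 1 := by
    rw [integral_eq_lintegral_of_nonneg_ae (Eventually.of_forall fun ω => (Real.exp_pos _).le)
      hexp.aestronglyMeasurable, h, ENNReal.toReal_one]
  have h2 := integral_mono (hf.1.add (integrable_const 1)) hexp
    fun ω => Real.add_one_le_exp (f ω)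
  have h3 := (hf.add (hasExpectation_const μ 1)).2
  simp only [Pi.add_apply] at h2
  linarith

end Transport

/-! ### Moments of a code and the converse in terms of them. -/

theorem memLp_iidGaussian (v : ℝ≥0) (i : Fin n) :
    MemLp (fun s : Fin n → ℝ => s i) 2 (iidGaussian n v) :=
  (memLp_id_gaussianReal (μ := 0) (v := v) 2).comp_measurePreserving
    (measurePreserving_eval (fun _ : Fin n => gaussianReal 0 v) i)

theorem hasExpectation_iidGaussian (v : ℝ≥0) (i : Fin n) :
    HasExpectation (iidGaussian n v) (fun s => s i) 0 := by
  have h : HasExpectation (gaussianReal 0 v) (fun x => x) 0 :=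
    ⟨(memLp_id_gaussianReal (μ := 0) (v := v) 1).integrable le_rfl, integral_id_gaussianReal⟩
  exact h.comp (measurePreserving_eval (fun _ : Fin n => gaussianReal 0 v) i)

theorem hasExpectation_iidGaussian_sq (v : ℝ≥0) (i : Fin n) :
    HasExpectation (iidGaussian n v) (fun s => s i * s i) v := by
  have h : HasExpectation (gaussianReal 0 v) (fun x => x * x) v := by
    have hL : MemLp (fun x : ℝ => x) 2 (gaussianReal 0 v) := memLp_id_gaussianReal 2
    refine ⟨hL.integrable_mul hL, ?_⟩
    have h := variance_of_integral_eq_zero (μ := gaussianReal 0 v) (X := id)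
      measurable_id.aemeasurable (by simp)
    simp only [variance_id_gaussianReal, id, sq] at h
    exact h.symm
  exact h.comp (measurePreserving_eval (fun _ : Fin n => gaussianReal 0 v) i)

/-- The estimation error of the decoder at one coordinate. -/
noncomputable def Code.error (code : Code n) (i : Fin n) (q : (Fin n → ℝ) × (Fin n → ℝ)) : ℝ :=
  q.1 i - code.dec (code.enc q.2 + q.1 + q.2) i

theorem Code.measurable_error (code : Code n) (i : Fin n) : Measurable (code.error i) := by
  have := code.measurable_enc
  have := code.measurable_dec
  unfold Code.error
  fun_prop

theorem Code.coordinateMoments (code : Code n) (p : ℝ≥0) (i : Fin n)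
    (hX : MemLp (fun s => code.enc s i) 2 (iidGaussian n p))
    (hE : MemLp (code.error i) 2 ((iidGaussian n 1).prod (iidGaussian n p))) :
    CoordinateMoments (((iidGaussian n 1).prod (iidGaussian n p)).prod (iidGaussian n 1))
      (fun ω => ω.1.1 i) (fun ω => ω.2 i) (fun ω => ω.1.2 i) (fun ω => code.enc ω.1.2 i)
      (fun ω => code.error i ω.1) p
      (∫ s, code.enc s i * code.enc s i ∂(iidGaussian n p))
      (∫ s, code.enc s i * s i ∂(iidGaussian n p))
      (∫ q, code.error i q * code.error i q ∂((iidGaussian n 1).prod (iidGaussian n p))) := by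
  have m1 : MeasurePreserving Prod.fst
      (((iidGaussian n 1).prod (iidGaussian n p)).prod (iidGaussian n 1)) _ :=
    measurePreserving_fst
  have m2 : MeasurePreserving Prod.snd
      (((iidGaussian n 1).prod (iidGaussian n p)).prod (iidGaussian n 1)) _ :=
    measurePreserving_snd
  have m11 : MeasurePreserving Prod.fst ((iidGaussian n 1).prod (iidGaussian n p)) _ :=
    measurePreserving_fst
  have m12 : MeasurePreserving Prod.snd ((iidGaussian n 1).prod (iidGaussian n p)) _ :=
    measurePreserving_snd
  have hS := memLp_iidGaussian p i
  have g1 := hasExpectation_iidGaussian 1 i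
  have g2 : HasExpectation (iidGaussian n 1) (fun s => s i * s i) 1 := by
    simpa using hasExpectation_iidGaussian_sq 1 i
  exact
    { noise_sq := (g2.comp m11).comp m1
      side_sq := g2.comp m2
      interference_sq := ((hasExpectation_iidGaussian_sq p i).comp m12).comp m1
      input_sq := ((MemLp.hasExpectation_mul hX hX).comp m12).comp m1
      error_sq := (MemLp.hasExpectation_mul hE hE).comp m1
      input_interference := ((MemLp.hasExpectation_mul hX hS).comp m12).comp m1
      noise_interference :=
        ((g1.prod_mul (MemLp.hasExpectation hS)).comp m1).congr (fun _ => rfl) (zero_mul _)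
      noise_input :=
        ((g1.prod_mul (MemLp.hasExpectation hX)).comp m1).congr (fun _ => rfl) (zero_mul _)
      noise_side := ((g1.comp m11).prod_mul g1).congr (fun _ => rfl) (zero_mul _)
      interference_side :=
        (((MemLp.hasExpectation hS).comp m12).prod_mul g1).congr (fun _ => rfl) (mul_zero _)
      input_side :=
        (((MemLp.hasExpectation hX).comp m12).prod_mul g1).congr (fun _ => rfl) (mul_zero _)
      error_side := ((MemLp.hasExpectation hE).prod_mul g1).congr (fun _ => rfl) (mul_zero _) }

/-- The converse at a finite block length, in terms of the power `x`, the correlation `w` of the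
channel input with the interference, and the distortion `e`. -/
theorem Code.exists_moments_bound (code : Code n) (hn : 0 < n) (p : ℝ≥0) {γ c α β κ : ℝ}
    (hγ : 1 ≤ γ) (hα : 0 < α) (hκ : 0 < κ) (hβ : β = κ + γ * (1 + c) ^ 2 * p)
    (hcost : code.cost p ≠ ∞) (hdist : code.distortion p ≠ ∞) :
    ∃ x w e : ℝ, 0 ≤ x ∧ 0 ≤ e ∧ w ^ 2 ≤ x * p ∧ code.cost p = ENNReal.ofReal x ∧
      code.distortion p = ENNReal.ofReal e ∧
      Real.log β - Real.log κ - Real.log α + 1 - (x + 2 * w + p + 1) / α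
        + (γ * (x + 2 * w + p) + 1) / β - (γ * (x - 2 * c * w + c ^ 2 * p) + 1) / κ
        ≤ (γ - 1) * e := by
  have hn0 : (0 : ℝ) < n := by exact_mod_cast hn
  have henc := code.measurable_enc
  obtain ⟨hX, hXe⟩ := memLp_two_of_lintegral_mean_sq hn (f := fun i s => code.enc s i)
    (fun i => by fun_prop) hcost
  obtain ⟨hE, hEe⟩ := memLp_two_of_lintegral_mean_sq hn (f := code.error)
    code.measurable_error hdist
  set x : Fin n → ℝ := fun i => ∫ s, code.enc s i * code.enc s i ∂(iidGaussian n p)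
  set w : Fin n → ℝ := fun i => ∫ s, code.enc s i * s i ∂(iidGaussian n p)
  set e : Fin n → ℝ := fun i =>
    ∫ q, code.error i q * code.error i q ∂((iidGaussian n 1).prod (iidGaussian n p))
  have hm : ∀ i, CoordinateMoments _ _ _ _ _ _ (p : ℝ) (x i) (w i) (e i) :=
    fun i => code.coordinateMoments p i (hX i) (hE i)
  have hx0 : ∀ i, 0 ≤ x i := fun i => integral_nonneg fun s => mul_self_nonneg _
  have he0 : ∀ i, 0 ≤ e i := fun i => integral_nonneg fun s => mul_self_nonneg _
  have hd : √(γ - 1) ^ 2 = γ - 1 := Real.sq_sqrt (by linarith)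
  have hγ0 : 0 < γ := by linarith
  refine ⟨(∑ i, x i) / n, (∑ i, w i) / n, (∑ i, e i) / n,
    div_nonneg (Finset.sum_nonneg fun i _ => hx0 i) hn0.le,
    div_nonneg (Finset.sum_nonneg fun i _ => he0 i) hn0.le, ?_, hXe, hEe, ?_⟩
  -- Cauchy-Schwarz for the averages: the mean over `i` of `E (Xᵢ - t Sᵢ)²` is a nonnegative
  -- quadratic in `t`.
  · have hq : ∀ t : ℝ, 0 ≤ p * (t * t) + (-2 * ((∑ i, w i) / n)) * t + (∑ i, x i) / n := by
      intro t
      have h1 : ∀ i, 0 ≤ x i + -2 * t * w i + t ^ 2 * p := fun i => by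
        have h := (hm i).linear_sq 1 (-t) 0 0
        have h0 := h.2 ▸ integral_nonneg fun ω => sq_nonneg _
        linarith
      have h2 := Finset.sum_nonneg fun i (_ : i ∈ Finset.univ) => h1 i
      simp only [Finset.sum_add_distrib, ← Finset.mul_sum, Finset.sum_const, Finset.card_univ,
        Fintype.card_fin, nsmul_eq_mul] at h2
      have h3 := div_nonneg h2 hn0.le
      refine h3.trans_eq ?_
      field_simp
      ring
    have := discrim_le_zero hq
    rw [discrim] at this
    linarith
  · have hL := HasExpectation.sum (s := Finset.univ)
      fun i => (hm i).logLikelihoodRatio (c := c) (α := α) (β := β) (κ := κ) hγ0 hd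
    have h := hL.nonpos_of_lintegral_exp
      (code.lintegral_exp_blockLogRatio p hγ0 hα hκ hβ hd)
    -- Being affine in the moments, the bound passes to their averages over the block.
    have hlin : ∀ i, (Real.log β - Real.log κ - Real.log α) / 2 + 1 / 2
        - (x i + 2 * w i + p + 1) / (2 * α) - (γ - 1) * e i / 2
        + (γ * (x i + 2 * w i + p) + 1) / (2 * β)
        - (γ * (x i - 2 * c * w i + c ^ 2 * p) + 1) / (2 * κ) =
        ((Real.log β - Real.log κ - Real.log α) / 2 + 1 / 2 - (p + 1) / (2 * α)
          + (γ * p + 1) / (2 * β) - (γ * (c ^ 2 * p) + 1) / (2 * κ))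
        + (-1 / (2 * α) + γ / (2 * β) - γ / (2 * κ)) * x i
        + (-1 / α + γ / β + γ * c / κ) * w i + (-(γ - 1) / 2) * e i := fun i => by ring
    simp only [hlin, Finset.sum_add_distrib, ← Finset.mul_sum, Finset.sum_const,
      Finset.card_univ, Fintype.card_fin, nsmul_eq_mul] at h
    have h3 := div_nonpos_of_nonpos_of_nonneg h hn0.le
    simp only [add_div, mul_div_assoc, mul_div_cancel_left₀ _ hn0.ne'] at h3
    ring_nf at h3 ⊢
    linarith

/-! ### Minimizing the quadratic in the root of the power. -/

/-- The minimum of `a x² - b x` over `[0, Q]`. -/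
theorem quadratic_ge_of_mem_interval {a b Q x xs : ℝ} (hb : 0 ≤ b) (hx0 : 0 ≤ x) (hxQ : x ≤ Q)
    (hxs : xs = if a ≤ 0 then Q else if b / (2 * a) < Q then b / (2 * a) else Q) :
    a * xs ^ 2 - b * xs ≤ a * x ^ 2 - b * x := by
  split_ifs at hxs with h1 h2
  · have : 0 ≤ b - a * (x + Q) := by
      have := mul_nonneg (neg_nonneg.2 h1) (by linarith : 0 ≤ x + Q)
      linarith
    rw [hxs]
    linarith [mul_nonneg (sub_nonneg.2 hxQ) this]
  · push Not at h1
    have h : a * x ^ 2 - b * x - (a * xs ^ 2 - b * xs) = a * (x - xs) ^ 2 := by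
      rw [hxs]; field_simp; ring
    linarith [mul_nonneg h1.le (sq_nonneg (x - xs))]
  · push Not at h1 h2
    rw [le_div_iff₀ (by positivity)] at h2
    have : 0 ≤ b - a * (x + Q) := by
      have := mul_le_mul_of_nonneg_left hxQ h1.le
      linarith
    rw [hxs]
    linarith [mul_nonneg (sub_nonneg.2 hxQ) this]

/-- The minimum of `a z² - b z` over `[0, √P]` changes by at most `|a| ε + b √ε` when `P` grows
by `ε`. -/
theorem quadratic_ge_of_sq_le_add {a b P ε z xs : ℝ} (hb : 0 ≤ b) (hε : 0 ≤ ε)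
    (hz0 : 0 ≤ z) (hz : z ^ 2 ≤ P + ε) (hP : 0 ≤ P)
    (hxs : xs = if a ≤ 0 then √P else if b / (2 * a) < √P then b / (2 * a) else √P) :
    a * xs ^ 2 - b * xs - (|a| * ε + b * √ε) ≤ a * z ^ 2 - b * z := by
  have hc : 0 ≤ |a| * ε + b * √ε := by positivity
  rcases le_or_gt z √P with h | h
  · linarith [quadratic_ge_of_mem_interval hb hz0 h hxs]
  · have h1 := quadratic_ge_of_mem_interval hb (Real.sqrt_nonneg P) le_rfl hxs
    have h3 : √P ^ 2 = P := Real.sq_sqrt hP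
    -- Past `√P`, compare with the value at `√P` itself.
    have h2 : z ≤ √P + √ε := by
      refine abs_le_of_sq_le_sq' (hz.trans ?_) (by positivity) |>.2
      have := mul_nonneg (Real.sqrt_nonneg P) (Real.sqrt_nonneg ε)
      linarith [add_sq (√P) (√ε), Real.sq_sqrt hε]
    have h4 : |a * (z ^ 2 - √P ^ 2)| ≤ |a| * ε := by
      rw [abs_mul]
      refine mul_le_mul_of_nonneg_left ?_ (abs_nonneg a)
      have : √P ^ 2 ≤ z ^ 2 := by gcongr
      rw [abs_of_nonneg (by linarith)]
      linarith
    have h5 := (abs_le.1 h4).1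
    have h6 := mul_le_mul_of_nonneg_left h2 hb
    linarith

/-! ### The converse for codes and its asymptotic form. -/

/-- The converse at a finite block length. -/
theorem Code.distortion_bound {n : ℕ} (code : Code n) (hn : 0 < n) (P₂ P ε : ℝ≥0) {γ c r : ℝ}
    (hγ : 1 ≤ γ) (hr : 0 ≤ r) {PI a b xs : ℝ}
    (hPI : PI = (1 + c) ^ 2 * P₂ + r * P) (hPI0 : PI ≠ 0)
    (ha : a = 1 / (PI * (1 + PI)) - 1 / (PI * (1 + γ * PI)) - γ / (1 + γ * (r * P)))
    (hb : b = |2 * (1 / (PI * (1 + PI)) - 1 / (PI * (1 + γ * PI))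
        + c * γ / (1 + γ * (r * P)))| * √(P₂ : ℝ))
    (hxs : xs = if a ≤ 0 then √(P : ℝ)
        else if b / (2 * a) < √(P : ℝ) then b / (2 * a) else √(P : ℝ))
    (hcost : code.cost P₂ ≤ ((P + ε : ℝ≥0) : ℝ≥0∞)) (hdist : code.distortion P₂ ≠ ∞) :
    Real.log ((1 + γ * PI) / (1 + PI)) + 1 / (1 + γ * PI) - 1 / (1 + PI)
        - P₂ / (PI * (1 + γ * PI)) + P₂ / (PI * (1 + PI))
        - c ^ 2 * γ / (1 + γ * (r * P)) * P₂
        - 1 / (1 + γ * (r * P)) + 1 + Real.log (1 / (1 + γ * (r * P)))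
        + a * xs ^ 2 - b * xs - (|a| * ε + b * √(ε : ℝ))
      ≤ (γ - 1) * (code.distortion P₂).toReal := by
  have hPIpos : 0 < PI := lt_of_le_of_ne (by rw [hPI]; positivity) hPI0.symm
  have hγ0 : 0 < γ := by linarith
  have hκ : 0 < 1 + γ * (r * P) := by positivity
  have hα : 0 < 1 + PI := by positivity
  have hβ : 0 < 1 + γ * PI := by positivity
  have hb0 : 0 ≤ b := by rw [hb]; positivity
  obtain ⟨x, w, e, hx, he, hw, hxc, hed, hbound⟩ := code.exists_moments_bound hn P₂ (c := c)
    (β := 1 + γ * PI) hγ hα hκ (by rw [hPI]; ring) (ne_top_of_le_ne_top ENNReal.coe_ne_top hcost)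
    hdist
  rw [hed, ENNReal.toReal_ofReal he]
  have hxP : √x ^ 2 ≤ (P : ℝ) + ε := by
    rw [Real.sq_sqrt hx]
    rw [hxc] at hcost
    have := ENNReal.toReal_mono ENNReal.coe_ne_top hcost
    rwa [ENNReal.toReal_ofReal hx] at this
  have hquad := quadratic_ge_of_sq_le_add (a := a) hb0 ε.coe_nonneg (Real.sqrt_nonneg x) hxP
    P.coe_nonneg hxs
  rw [Real.sq_sqrt hx] at hquad
  have hwabs : |w| ≤ √x * √(P₂ : ℝ) := by
    rw [← Real.sqrt_mul hx]
    exact Real.abs_le_sqrt hw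
  set k : ℝ := 2 * (1 / (PI * (1 + PI)) - 1 / (PI * (1 + γ * PI))
    + c * γ / (1 + γ * (r * P))) with hk
  have hkw : -(b * √x) ≤ k * w := by
    have h1 := mul_le_mul_of_nonneg_left hwabs (abs_nonneg k)
    rw [← abs_mul] at h1
    have h2 := (abs_le.1 h1).1
    rw [hb]
    linarith
  refine le_trans ?_ hbound
  rw [Real.log_div hβ.ne' hα.ne', one_div (1 + γ * (r * P)), Real.log_inv]
  -- Partial fractions: the right side is the form in which `α` and `β` produce the coefficients of
  -- `x` and `w`.
  have hcoef : 1 / (PI * (1 + PI)) - 1 / (PI * (1 + γ * PI)) = γ / (1 + γ * PI) - 1 / (1 + PI) := by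
    field_simp
    ring
  have hP₂ : (P₂ : ℝ) / (PI * (1 + PI)) - P₂ / (PI * (1 + γ * PI))
      = P₂ * (γ / (1 + γ * PI) - 1 / (1 + PI)) := by
    rw [← hcoef]; ring
  rw [hcoef] at ha hk
  have hmain : Real.log (1 + γ * PI) - Real.log (1 + γ * (r * P)) - Real.log (1 + PI) + 1
        - (x + 2 * w + P₂ + 1) / (1 + PI) + (γ * (x + 2 * w + P₂) + 1) / (1 + γ * PI)
        - (γ * (x - 2 * c * w + c ^ 2 * P₂) + 1) / (1 + γ * (r * P)) =
      Real.log (1 + γ * PI) - Real.log (1 + PI) + 1 / (1 + γ * PI) - 1 / (1 + PI)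
        + P₂ * (γ / (1 + γ * PI) - 1 / (1 + PI)) - c ^ 2 * γ / (1 + γ * (r * P)) * P₂
        - (1 + γ * (r * P))⁻¹ + 1 - Real.log (1 + γ * (r * P)) + a * x + k * w := by
    rw [ha, hk]; ring
  rw [hmain]
  linarith

/-- An affine lower bound on the distortion of all codes, with a slack that vanishes with the
excess power, holds for the minimum distortion. -/
theorem le_mul_minDistortion {P₂ P : ℝ≥0} {g K : ℝ} (hg : 0 ≤ g) {δ : ℝ≥0 → ℝ}
    (hδ : Tendsto δ (𝓝 0) (𝓝 0))
    (h : ∀ (n : ℕ) (code : Code n) (ε : ℝ≥0), 0 < n → code.cost P₂ ≤ ((P + ε : ℝ≥0) : ℝ≥0∞) →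
      code.distortion P₂ ≠ ∞ → K - δ ε ≤ g * (code.distortion P₂).toReal) :
    K ≤ g * (minDistortion P₂ P : ℝ) := by
  have hach : ∀ D : ℝ≥0, Achievable P₂ P D → K ≤ g * (D : ℝ) := by
    rintro D ⟨ε, code, hε, hcost, hlim⟩
    have hη : ∀ η : ℝ≥0, 0 < η → K ≤ g * ((D + η : ℝ≥0) : ℝ) := by
      intro η hη
      have hlt : limsup (fun n => (code n).distortion P₂) atTop < ((D + η : ℝ≥0) : ℝ≥0∞) :=
        hlim.trans_lt (by exact_mod_cast lt_add_of_pos_right D hη)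
      have hev : ∀ᶠ n in atTop, K - δ (ε n) ≤ g * ((D + η : ℝ≥0) : ℝ) := by
        filter_upwards [eventually_lt_of_limsup_lt hlt, eventually_gt_atTop 0] with n hn hn0
        refine (h n (code n) (ε n) hn0 (hcost n) hn.ne_top).trans ?_
        exact mul_le_mul_of_nonneg_left (ENNReal.toReal_mono ENNReal.coe_ne_top hn.le) hg
      have ht : Tendsto (fun n => K - δ (ε n)) atTop (𝓝 (K - 0)) :=
        tendsto_const_nhds.sub (hδ.comp hε)
      simpa using le_of_tendsto ht hev
    have ht : Tendsto (fun η : ℝ => g * (D + η)) (𝓝[>] 0) (𝓝 (g * (D + 0))) :=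
      (((continuous_const.add continuous_id).const_mul g).tendsto 0).mono_left
        nhdsWithin_le_nhds
    rw [add_zero] at ht
    refine ge_of_tendsto ht ?_
    filter_upwards [self_mem_nhdsWithin] with η (hη0 : 0 < η)
    simpa [Real.coe_toNNReal _ hη0.le] using hη η.toNNReal (by simpa using hη0)
  have hne : {D : ℝ≥0 | Achievable P₂ P D}.Nonempty := ⟨1, achievable_one P₂ P⟩
  -- For `g = 0` (that is, `γ = 1`) one cannot divide by `g`, but any achievable distortion already
  -- gives `K ≤ 0`.
  rcases hg.eq_or_lt with rfl | hg
  · simpa using hach 1 (achievable_one P₂ P)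
  · have h1 : (K / g).toNNReal ≤ minDistortion P₂ P := by
      refine le_csInf hne fun D hD => Real.toNNReal_le_iff_le_coe.2 ?_
      rw [div_le_iff₀' hg]
      exact hach D hD
    rw [← div_le_iff₀' hg]
    exact Real.toNNReal_le_iff_le_coe.1 h1

end GaussianHelper

theorem theorem7 (P₂ P : ℝ≥0) (γ c r : ℝ) (hγ : 1 ≤ γ) (hr : 0 ≤ r)
    (PI a b xs : ℝ)
    (hPI : PI = (1 + c) ^ 2 * P₂ + r * P)
    (hPI0 : PI ≠ 0)
    (ha : a = 1 / (PI * (1 + PI)) - 1 / (PI * (1 + γ * PI)) - γ / (1 + γ * (r * P)))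
    (hb : b = |2 * (1 / (PI * (1 + PI)) - 1 / (PI * (1 + γ * PI))
        + c * γ / (1 + γ * (r * P)))| * √(P₂ : ℝ))
    (hxs : xs = if a ≤ 0 then √(P : ℝ)
        else if b / (2 * a) < √(P : ℝ) then b / (2 * a) else √(P : ℝ)) :
    (γ - 1) * (GaussianHelper.minDistortion P₂ P : ℝ) ≥
      Real.log ((1 + γ * PI) / (1 + PI)) + 1 / (1 + γ * PI) - 1 / (1 + PI)
        - P₂ / (PI * (1 + γ * PI)) + P₂ / (PI * (1 + PI))
        - c ^ 2 * γ / (1 + γ * (r * P)) * P₂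
        - 1 / (1 + γ * (r * P)) + 1 + Real.log (1 / (1 + γ * (r * P)))
        + a * xs ^ 2 - b * xs := by 
  have hδ : Tendsto (fun ε : ℝ≥0 => |a| * (ε : ℝ) + b * √(ε : ℝ)) (𝓝 0) (𝓝 0) := by
    have h : Continuous fun ε : ℝ≥0 => |a| * (ε : ℝ) + b * √(ε : ℝ) := by fun_prop
    simpa using h.tendsto 0
  exact GaussianHelper.le_mul_minDistortion (by linarith) hδ fun n code ε hn hcost hdist =>
    code.distortion_bound hn P₂ P ε hγ hr hPI hPI0 ha hb hxs hcost hdist
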